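/- Let $A=(a_{ij})_{i,j=1}^n$ be the Cartan matrix of a complex semisimple Lie algebra $\mathfrak g$ with simple roots $\alpha_1,\dots,\alpha_n$ and root lattice $Q=\bigoplus_i\mathbb Z\alpha_i$. Let $d_i\in\{1,2,3\}$ be such that $(d_ia_{ij})$ is symmetric and positive definite, and put $(\alpha_i,\alpha_j)=d_ia_{ij}$. Let $q$ be a non-zero real number that is not a root of unity, put $q_i=q^{d_i}$, and let $U=U_q(\mathfrak g)$ be the unital complex algebra generated by $E_i,F_i,K_i^{\pm1}$ $(1\le i\le n)$ with the relations $K_iK_i^{-1}=K_i^{-1}K_i=1$, $K_iK_j=K_jK_i$, $K_iE_jK_i^{-1}=q_i^{a_{ij}}E_j$, $K_iF_jK_i^{-1}=q_i^{-a_{ij}}F_j$, $E_iF_j-F_jE_i=\delta_{ij}\frac{K_i-K_i^{-1}}{q_i-q_i^{-1}}$ and the $q$-Serre relations for the $E_i$ and for the $F_i$. Let $U^+,U^-,U^0$ be the subalgebras generated by the $E_i$, by the $F_i$ and by the $K_i^{\pm1}$. For $\gamma\in Q$ let $U_\gamma=\{X\in U: K_iXK_i^{-1}=q^{(\alpha_i,\gamma)}X\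 \forall i\}$ and $U^\pm_\gamma=U^\pm\cap U_\gamma$. Thus $U=\bigoplus_{\gamma\in Q}U_\gamma$, and $U_0$ is the centralizer of $U^0$ in $U$. Let $\eta$ be an involutive automorphism of the Dynkin diagram of $\mathfrak g$ (possibly the identity) and let $s_i\in\{\pm1\}$ with $s_i=1$ whenever $\eta(i)\ne i$. Equip $U$ with the conjugate-linear anti-multiplicative involution $*$ given by $$K_i^*=K_{\eta(i)},\qquad E_i^*=s_iF_{\eta(i)}K_{\eta(i)},\qquad F_i^*=s_iK_{\eta(i)}^{-1}E_{\eta(i)}.$$ Let $S\subset\{1,\dots,n\}$ be such that $a_{ij}=0$ for all $i\ne j$ in $S$. Let $\lambda\colon U^0\to\mathbb C$ be an algebra homomorphism and let $\mu_i\in\mathbb C\setminus\{0\}$ for $i\in S$. Let $\phi=\phi^S_{\lambda,\mu}\colon U_0\to\mathbb C$ be the one-dimensional representation that restricts to $\lambda$ on $U^0$, satisfies $\phi(E_iF_i)=\mu_i$ for $i\in S$, and vanishes on $I^S=\sum_\gamma U^+_\gamma U^0U^-_{-\gamma}$, where the sum is over all $\gamma=\sum_jb_j\alpha_j$ with all $b_j\in\mathbb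 Z_{\ge0}$ and $b_i>0$ for some $i\notin S$. Let $\mathbb C^S_{\lambda,\mu}$ be $\mathbb C$ with $U_0$ acting through $\phi$, and let $M=M(\mathbb C^S_{\lambda,\mu})=U\otimes_{U_0}\mathbb C^S_{\lambda,\mu}$. Extend $\phi$ to a linear functional on $U$ by first projecting $U=\bigoplus_\gamma U_\gamma$ onto $U_0$, and suppose that this extension is positive, i.e. $\phi(X^*X)\ge0$ for all $X\in U$. Then $$N=\{X\cdot(1\otimes1)\mid X\in U,\ \phi(X^*X)=0\}$$ is a $U$-submodule of $M$, and $M/N$ is an irreducible unitary $U$-module. More precisely, $M/N$ is a simple $U$-module, and there is an inner product on $M/N$, linear in the first variable, with $\langle X\cdot(1\otimes1)+N,\ Y\cdot(1\otimes1)+N\rangle=\phi(Y^*X)$ for all $X,Y\in U$ and $\langle Xu,w\rangle=\langle u,X^*w\rangle$ for all $X\in U$ and $u,w\in M/N$. -/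

import Mathlib

open scoped TensorProduct ComplexOrder

noncomputable section

namespace QuantumMathieu

/-- The combinatorial datum of a complex semisimple Lie algebra of rank `n` with chosen simple
roots: its Cartan matrix `A` and integers `d i ∈ {1, 2, 3}` such that `diag d * A` is symmetric
and positive definite. -/
structure CartanDatum (n : ℕ) where
  A : Matrix (Fin n) (Fin n) ℤ
  d : Fin n → ℕ
  A_diag : ∀ i, A i i = 2
  A_offDiag : ∀ i j, i ≠ j → A i j ≤ 0
  d_mem : ∀ i, d i = 1 ∨ d i = 2 ∨ d i = 3
  symm : ∀ i j, (d i : ℤ) * A i j = (d j : ℤ) * A j i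
  posDef : (Matrix.of fun i j => ((d i : ℝ) * (A i j : ℝ))).PosDef

/-- The root lattice, in coordinates with respect to the simple roots. -/
abbrev RootLattice (n : ℕ) : Type := Fin n → ℤ

/-- The pairing `(α_i, γ)`, where `(α_i, α_j) = d_i a_{ij}`. -/
def CartanDatum.pair {n : ℕ} (C : CartanDatum n) (i : Fin n) (γ : RootLattice n) : ℤ :=
  ∑ j, (C.d i : ℤ) * C.A i j * γ j

/-- The simple root `α_i`. -/
def simpleRoot {n : ℕ} (i : Fin n) : RootLattice n := Pi.single i 1

section QNumbers

/-- The `q`-integer `[j]_q`. -/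
def qInt (q : ℂ) (j : ℕ) : ℂ := (q ^ j - (q ^ j)⁻¹) / (q - q⁻¹)

/-- The `q`-factorial `[k]_q!`. -/
def qFact (q : ℂ) (k : ℕ) : ℂ := ∏ j ∈ Finset.Icc 1 k, qInt q j

/-- The `q`-binomial coefficient, used for `k ≤ n`. -/
def qBinom (q : ℂ) (n k : ℕ) : ℂ := qFact q n / (qFact q k * qFact q (n - k))

/-- The left-hand side of the `q`-Serre relation,
`∑_{r=0}^m (-1)^r [m choose r]_p x^{m-r} y x^r`. -/
def serre {R : Type*} [Ring R] [Algebra ℂ R] (p : ℂ) (m : ℕ) (x y : R) : R :=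
  ∑ r ∈ Finset.range (m + 1), ((-1) ^ r * qBinom p m r) • (x ^ (m - r) * y * x ^ r)

end QNumbers

/-- Symbols for the generators of the quantized enveloping algebra. -/
inductive Gen (n : ℕ) : Type
  | E (i : Fin n)
  | F (i : Fin n)
  | K (i : Fin n)
  | Kinv (i : Fin n)

section Algebra

variable {n : ℕ} (C : CartanDatum n) (q : ℂ)

/-- The free algebra on the generators. -/
abbrev FreeGen (n : ℕ) : Type := FreeAlgebra ℂ (Gen n)

/-- A generator as an element of the free algebra. -/
abbrev g {n : ℕ} (x : Gen n) : FreeGen n := FreeAlgebra.ι ℂ x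

/-- `q_i = q^{d_i}`. -/
def qi (i : Fin n) : ℂ := q ^ C.d i

/-- The degree `1 - a_{ij}` of the Serre relation for `i ≠ j`. -/
def serreDeg (i j : Fin n) : ℕ := (1 - C.A i j).toNat

/-- The defining relations of the quantized enveloping algebra. -/
inductive Rel : FreeGen n → FreeGen n → Prop
  | K_Kinv (i : Fin n) : Rel (g (.K i) * g (.Kinv i)) 1
  | Kinv_K (i : Fin n) : Rel (g (.Kinv i) * g (.K i)) 1
  | K_comm (i j : Fin n) : Rel (g (.K i) * g (.K j)) (g (.K j) * g (.K i))
  | K_E (i j : Fin n) :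
      Rel (g (.K i) * g (.E j) * g (.Kinv i)) ((qi C q i ^ C.A i j) • g (.E j))
  | K_F (i j : Fin n) :
      Rel (g (.K i) * g (.F j) * g (.Kinv i)) ((qi C q i ^ (-C.A i j)) • g (.F j))
  | E_F_same (i : Fin n) :
      Rel (g (.E i) * g (.F i) - g (.F i) * g (.E i))
        ((qi C q i - (qi C q i)⁻¹)⁻¹ • (g (.K i) - g (.Kinv i)))
  | E_F_diff (i j : Fin n) (h : i ≠ j) :
      Rel (g (.E i) * g (.F j) - g (.F j) * g (.E i)) 0
  | serre_E (i j : Fin n) (h : i ≠ j) :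
      Rel (serre (qi C q i) (serreDeg C i j) (g (.E i)) (g (.E j))) 0
  | serre_F (i j : Fin n) (h : i ≠ j) :
      Rel (serre (qi C q i) (serreDeg C i j) (g (.F i)) (g (.F j))) 0

/-- The quantized enveloping algebra `U_q(𝔤)`. -/
def Uq : Type := RingQuot (Rel C q)

instance : Ring (Uq C q) := inferInstanceAs (Ring (RingQuot (Rel C q)))

instance : Algebra ℂ (Uq C q) := inferInstanceAs (Algebra ℂ (RingQuot (Rel C q)))

/-- The canonical projection of the free algebra onto `U_q(𝔤)`. -/
def Uq.mk : FreeGen n →ₐ[ℂ] Uq C q := RingQuot.mkAlgHom ℂ (Rel C q)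

/-- The generator `E_i`. -/
def Uq.E (i : Fin n) : Uq C q := Uq.mk C q (g (.E i))

/-- The generator `F_i`. -/
def Uq.F (i : Fin n) : Uq C q := Uq.mk C q (g (.F i))

/-- The generator `K_i`. -/
def Uq.K (i : Fin n) : Uq C q := Uq.mk C q (g (.K i))

/-- The generator `K_i⁻¹`. -/
def Uq.Kinv (i : Fin n) : Uq C q := Uq.mk C q (g (.Kinv i))

theorem Uq.mk_rel {x y : FreeGen n} (h : Rel C q x y) : Uq.mk C q x = Uq.mk C q y :=
  RingQuot.mkAlgHom_rel ℂ h

theorem map_serre {R T : Type*} [Ring R] [Algebra ℂ R] [Ring T] [Algebra ℂ T]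
    (f : R →ₐ[ℂ] T) (p : ℂ) (m : ℕ) (x y : R) :
    f (serre p m x y) = serre p m (f x) (f y) := by
  simp [serre, map_sum]

theorem Uq.K_mul_Kinv (i : Fin n) : Uq.K C q i * Uq.Kinv C q i = 1 := by
  simpa [Uq.K, Uq.Kinv, Uq.E, Uq.F] using Uq.mk_rel C q (.K_Kinv i)

theorem Uq.Kinv_mul_K (i : Fin n) : Uq.Kinv C q i * Uq.K C q i = 1 := by
  simpa [Uq.K, Uq.Kinv, Uq.E, Uq.F] using Uq.mk_rel C q (.Kinv_K i)

theorem Uq.K_mul_K (i j : Fin n) : Uq.K C q i * Uq.K C q j = Uq.K C q j * Uq.K C q i := by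
  simpa [Uq.K, Uq.Kinv, Uq.E, Uq.F] using Uq.mk_rel C q (.K_comm i j)

theorem Uq.K_E_Kinv (i j : Fin n) :
    Uq.K C q i * Uq.E C q j * Uq.Kinv C q i = (qi C q i ^ C.A i j) • Uq.E C q j := by
  simpa [Uq.K, Uq.Kinv, Uq.E, Uq.F] using Uq.mk_rel C q (.K_E i j)

theorem Uq.K_F_Kinv (i j : Fin n) :
    Uq.K C q i * Uq.F C q j * Uq.Kinv C q i = (qi C q i ^ (-C.A i j)) • Uq.F C q j := by
  have := Uq.mk_rel C q (.K_F i j)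
  rwa [map_mul, map_mul, map_smul] at this

theorem Uq.E_F_same (i : Fin n) :
    Uq.E C q i * Uq.F C q i - Uq.F C q i * Uq.E C q i =
      (qi C q i - (qi C q i)⁻¹)⁻¹ • (Uq.K C q i - Uq.Kinv C q i) := by
  have := Uq.mk_rel C q (.E_F_same i)
  rwa [map_sub, map_mul, map_mul, map_smul, map_sub] at this

theorem Uq.E_F_diff (i j : Fin n) (h : i ≠ j) :
    Uq.E C q i * Uq.F C q j - Uq.F C q j * Uq.E C q i = 0 := by
  have := Uq.mk_rel C q (.E_F_diff i j h)
  rwa [map_sub, map_mul, map_mul, map_zero] at this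

theorem Uq.serre_E (i j : Fin n) (h : i ≠ j) :
    serre (qi C q i) (serreDeg C i j) (Uq.E C q i) (Uq.E C q j) = 0 := by
  have := Uq.mk_rel C q (.serre_E i j h)
  rwa [map_serre, map_zero] at this

theorem Uq.serre_F (i j : Fin n) (h : i ≠ j) :
    serre (qi C q i) (serreDeg C i j) (Uq.F C q i) (Uq.F C q j) = 0 := by
  have := Uq.mk_rel C q (.serre_F i j h)
  rwa [map_serre, map_zero] at this

/-- The subalgebra `U⁺` generated by the `E_i`. -/
def Uplus : Subalgebra ℂ (Uq C q) := Algebra.adjoin ℂ (Set.range (Uq.E C q))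

/-- The subalgebra `U⁻` generated by the `F_i`. -/
def Uminus : Subalgebra ℂ (Uq C q) := Algebra.adjoin ℂ (Set.range (Uq.F C q))

/-- The subalgebra `U⁰` generated by the `K_i` and `K_i⁻¹`. -/
def Ucartan : Subalgebra ℂ (Uq C q) :=
  Algebra.adjoin ℂ (Set.range (Uq.K C q) ∪ Set.range (Uq.Kinv C q))

/-- The root space `U_γ = {X | K_i X K_i⁻¹ = q^{(α_i, γ)} X for all i}`. -/
def rootSpace (γ : RootLattice n) : Submodule ℂ (Uq C q) where
  carrier := {X | ∀ i, Uq.K C q i * X * Uq.Kinv C q i = (q ^ C.pair i γ) • X}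
  add_mem' := fun {X Y} hX hY i => by
    rw [mul_add, add_mul, hX i, hY i, smul_add]
  zero_mem' := fun i => by simp
  smul_mem' := fun c X hX i => by
    rw [mul_smul_comm, smul_mul_assoc, hX i, smul_comm]

/-- `U⁺_γ = U⁺ ∩ U_γ`. -/
def UplusRoot (γ : RootLattice n) : Submodule ℂ (Uq C q) :=
  Subalgebra.toSubmodule (Uplus C q) ⊓ rootSpace C q γ

/-- `U⁻_γ = U⁻ ∩ U_γ`. -/
def UminusRoot (γ : RootLattice n) : Submodule ℂ (Uq C q) :=
  Subalgebra.toSubmodule (Uminus C q) ⊓ rootSpace C q γ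

/-- `U_{0,γ} = U⁺_γ U⁰ U⁻_{-γ}`. -/
def UzeroRoot (γ : RootLattice n) : Submodule ℂ (Uq C q) :=
  UplusRoot C q γ * Subalgebra.toSubmodule (Ucartan C q) * UminusRoot C q (-γ)

/-- `I^S`, the sum of the `U_{0,γ}` over those `γ = ∑ b_j α_j ∈ Q⁺` with `b_i > 0` for some
`i ∉ S`. -/
def idealI (S : Finset (Fin n)) : Submodule ℂ (Uq C q) :=
  ⨆ γ ∈ {γ : RootLattice n | (∀ j, 0 ≤ γ j) ∧ ∃ i, i ∉ S ∧ 0 < γ i}, UzeroRoot C q γ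

/-- `U_0`, the centralizer of `U⁰` in `U_q(𝔤)`; see `mem_Uzero_iff` for `U_0` as the root space of
`γ = 0`. -/
def Uzero : Subalgebra ℂ (Uq C q) := Subalgebra.centralizer ℂ (Ucartan C q : Set (Uq C q))

theorem commute_Kinv {i : Fin n} {X : Uq C q} (h : Uq.K C q i * X = X * Uq.K C q i) :
    Uq.Kinv C q i * X = X * Uq.Kinv C q i := by
  calc Uq.Kinv C q i * X
      = Uq.Kinv C q i * (X * Uq.K C q i) * Uq.Kinv C q i := by
        rw [mul_assoc, mul_assoc, Uq.K_mul_Kinv, mul_one]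
    _ = X * Uq.Kinv C q i := by
        rw [← h, ← mul_assoc, Uq.Kinv_mul_K, one_mul]

theorem mem_Uzero_of_commute {X : Uq C q}
    (h : ∀ i, Uq.K C q i * X = X * Uq.K C q i) : X ∈ Uzero C q := by
  have hle : Ucartan C q ≤ Subalgebra.centralizer ℂ ({X} : Set (Uq C q)) := by
    refine Algebra.adjoin_le ?_
    rintro _ (⟨i, rfl⟩ | ⟨i, rfl⟩)
    · exact (Subalgebra.mem_centralizer_iff ℂ).2 fun y hy => by
        rw [Set.mem_singleton_iff.1 hy, h i]
    · exact (Subalgebra.mem_centralizer_iff ℂ).2 fun y hy => by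
        rw [Set.mem_singleton_iff.1 hy, commute_Kinv C q (h i)]
  refine (Subalgebra.mem_centralizer_iff ℂ).2 fun y hy => ?_
  exact ((Subalgebra.mem_centralizer_iff ℂ).1 (hle hy) X rfl).symm

theorem mem_Uzero_iff {X : Uq C q} : X ∈ Uzero C q ↔ X ∈ rootSpace C q 0 := by
  have hp : ∀ i, q ^ C.pair i 0 = 1 := fun i => by simp [CartanDatum.pair]
  constructor
  · intro hX i
    have := (Subalgebra.mem_centralizer_iff ℂ).1 hX (Uq.K C q i)
      (Algebra.subset_adjoin (Or.inl ⟨i, rfl⟩))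
    rw [hp, one_smul, this, mul_assoc, Uq.K_mul_Kinv, mul_one]
  · intro hX
    refine mem_Uzero_of_commute C q fun i => ?_
    have := hX i
    rw [hp, one_smul] at this
    conv_rhs => rw [← this]
    rw [mul_assoc, Uq.Kinv_mul_K, mul_one]

theorem Ucartan_le_Uzero : Ucartan C q ≤ Uzero C q := by
  refine Algebra.adjoin_le ?_
  rintro _ (⟨i, rfl⟩ | ⟨i, rfl⟩)
  · exact mem_Uzero_of_commute C q fun j => Uq.K_mul_K C q j i
  · exact mem_Uzero_of_commute C q fun j =>
      (commute_Kinv C q (Uq.K_mul_K C q i j)).symm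

/-- The root of a generator. -/
def Gen.root {n : ℕ} : Gen n → RootLattice n
  | .E i => simpleRoot i
  | .F i => -simpleRoot i
  | .K _ => 0
  | .Kinv _ => 0

theorem pair_simpleRoot (i j : Fin n) : C.pair i (simpleRoot j) = (C.d i : ℤ) * C.A i j := by
  simp [CartanDatum.pair, simpleRoot, Pi.single_apply]

theorem pair_neg (i : Fin n) (γ : RootLattice n) : C.pair i (-γ) = -C.pair i γ := by
  simp [CartanDatum.pair]

theorem pair_add (i : Fin n) (β γ : RootLattice n) :
    C.pair i (β + γ) = C.pair i β + C.pair i γ := by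
  simp [CartanDatum.pair, mul_add, Finset.sum_add_distrib]

theorem gen_mem_rootSpace (x : Gen n) : Uq.mk C q (g x) ∈ rootSpace C q x.root := by
  intro i
  cases x with
  | E j =>
    have := Uq.K_E_Kinv C q i j
    simp only [Gen.root, pair_simpleRoot]
    rw [zpow_mul, zpow_natCast]
    exact this
  | F j =>
    have := Uq.K_F_Kinv C q i j
    simp only [Gen.root, pair_neg, pair_simpleRoot]
    rw [← mul_neg, zpow_mul, zpow_natCast]
    exact this
  | K j =>
    have h : Uq.K C q j ∈ Uzero C q :=
      Ucartan_le_Uzero C q (Algebra.subset_adjoin (Or.inl ⟨j, rfl⟩))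
    exact (mem_Uzero_iff C q).1 h i
  | Kinv j =>
    have h : Uq.Kinv C q j ∈ Uzero C q :=
      Ucartan_le_Uzero C q (Algebra.subset_adjoin (Or.inr ⟨j, rfl⟩))
    exact (mem_Uzero_iff C q).1 h i

theorem mul_mem_rootSpace (hq : q ≠ 0) {β γ : RootLattice n} {X Y : Uq C q}
    (hX : X ∈ rootSpace C q β) (hY : Y ∈ rootSpace C q γ) :
    X * Y ∈ rootSpace C q (β + γ) := by
  intro i
  calc Uq.K C q i * (X * Y) * Uq.Kinv C q i
      = (Uq.K C q i * X * Uq.Kinv C q i) * (Uq.K C q i * Y * Uq.Kinv C q i) := by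
        simp only [mul_assoc]
        rw [← mul_assoc (Uq.Kinv C q i) (Uq.K C q i), Uq.Kinv_mul_K, one_mul]
    _ = _ := by
        rw [hX i, hY i, smul_mul_smul_comm, pair_add, zpow_add₀ hq]

/-- The algebra homomorphism from the free algebra to `U_q(𝔤)[Q]` that sends a generator `x`
to `x · e^{root x}`. -/
def gradeFree : FreeGen n →ₐ[ℂ] AddMonoidAlgebra (Uq C q) (RootLattice n) :=
  FreeAlgebra.lift ℂ fun x => AddMonoidAlgebra.single x.root (Uq.mk C q (g x))

theorem gradeFree_g (x : Gen n) :
    gradeFree C q (g x) = AddMonoidAlgebra.single x.root (Uq.mk C q (g x)) := by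
  simp [gradeFree]

theorem serre_single {R : Type*} [Ring R] [Algebra ℂ R] (p : ℂ) (m : ℕ)
    (β γ : RootLattice n) (x y : R) :
    serre p m (AddMonoidAlgebra.single β x) (AddMonoidAlgebra.single γ y) =
      AddMonoidAlgebra.single (m • β + γ) (serre p m x y) := by
  simp only [serre]
  rw [show AddMonoidAlgebra.single (m • β + γ) = AddMonoidAlgebra.singleAddHom (R := R)
    (m • β + γ) from rfl, map_sum]
  refine Finset.sum_congr rfl fun r hr => ?_
  have hr' : r ≤ m := Nat.lt_succ_iff.1 (Finset.mem_range.1 hr)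
  have hβ : (m - r) • β + γ + r • β = m • β + γ := by
    rw [add_right_comm, ← add_smul, Nat.sub_add_cancel hr']
  rw [AddMonoidAlgebra.single_pow, AddMonoidAlgebra.single_pow,
    AddMonoidAlgebra.single_mul_single, AddMonoidAlgebra.single_mul_single, hβ]
  exact AddMonoidAlgebra.smul_single _ _ _

theorem gradeFree_rel {x y : FreeGen n} (h : Rel C q x y) :
    gradeFree C q x = gradeFree C q y := by
  have hr := Uq.mk_rel C q h
  cases h with
  | K_Kinv i =>
    simp only [map_mul, map_one, gradeFree_g, AddMonoidAlgebra.single_mul_single] at hr ⊢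
    rw [hr]; simp [Gen.root, AddMonoidAlgebra.one_def]
  | Kinv_K i =>
    simp only [map_mul, map_one, gradeFree_g, AddMonoidAlgebra.single_mul_single] at hr ⊢
    rw [hr]; simp [Gen.root, AddMonoidAlgebra.one_def]
  | K_comm i j =>
    simp only [map_mul, gradeFree_g, AddMonoidAlgebra.single_mul_single] at hr ⊢
    rw [hr]; simp [Gen.root]
  | K_E i j =>
    simp only [map_mul, map_smul, gradeFree_g, AddMonoidAlgebra.single_mul_single,
      AddMonoidAlgebra.smul_single] at hr ⊢
    rw [hr]; simp [Gen.root]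
  | K_F i j =>
    simp only [map_mul, map_smul, gradeFree_g, AddMonoidAlgebra.single_mul_single,
      AddMonoidAlgebra.smul_single] at hr ⊢
    rw [hr]; simp [Gen.root]
  | E_F_same i =>
    simp only [map_mul, map_sub, map_smul, gradeFree_g, AddMonoidAlgebra.single_mul_single,
      Gen.root, add_neg_cancel, neg_add_cancel, ← AddMonoidAlgebra.single_sub,
      AddMonoidAlgebra.smul_single] at hr ⊢
    rw [hr]
  | E_F_diff i j h =>
    simp only [map_mul, map_sub, map_zero, gradeFree_g, AddMonoidAlgebra.single_mul_single,
      Gen.root] at hr ⊢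
    rw [add_comm (-simpleRoot j), ← AddMonoidAlgebra.single_sub, hr,
      AddMonoidAlgebra.single_zero]
  | serre_E i j h =>
    rw [map_serre, map_zero] at hr ⊢
    rw [gradeFree_g, gradeFree_g, serre_single, hr, AddMonoidAlgebra.single_zero]
  | serre_F i j h =>
    rw [map_serre, map_zero] at hr ⊢
    rw [gradeFree_g, gradeFree_g, serre_single, hr, AddMonoidAlgebra.single_zero]

/-- The algebra homomorphism `U_q(𝔤) → U_q(𝔤)[Q]` sending `X` to `∑_γ X_γ e^γ`, where
`X = ∑_γ X_γ` is the decomposition of `X` along `U_q(𝔤) = ⨁_γ U_γ`; see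
`component_mem_rootSpace` and `sum_component`. -/
def grade : Uq C q →ₐ[ℂ] AddMonoidAlgebra (Uq C q) (RootLattice n) :=
  RingQuot.liftAlgHom ℂ ⟨gradeFree C q, fun _ _ h => gradeFree_rel C q h⟩

theorem grade_mk (x : FreeGen n) : grade C q (Uq.mk C q x) = gradeFree C q x :=
  RingQuot.liftAlgHom_mkAlgHom_apply ℂ _ _ x

theorem Uq.mk_surjective : Function.Surjective (Uq.mk C q) :=
  RingQuot.mkAlgHom_surjective ℂ _

/-- The projection of `U_q(𝔤)` onto `U_γ` along the root space decomposition. -/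
def component (γ : RootLattice n) : Uq C q →ₗ[ℂ] Uq C q where
  toFun X := (grade C q X).coeff γ
  map_add' X Y := by simp
  map_smul' c X := by simp

theorem component_mem_rootSpace (hq : q ≠ 0) (X : Uq C q) (γ : RootLattice n) :
    component C q γ X ∈ rootSpace C q γ := by
  obtain ⟨x, rfl⟩ := Uq.mk_surjective C q X
  change (grade C q (Uq.mk C q x)).coeff γ ∈ _
  rw [grade_mk]
  induction x using FreeAlgebra.induction generalizing γ with
  | grade0 c =>
    rw [AlgHom.commutes, AddMonoidAlgebra.coe_algebraMap, Function.comp_apply,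
      AddMonoidAlgebra.coeff_single, Finsupp.single_apply]
    split_ifs with h
    · subst h
      exact (mem_Uzero_iff C q).1 (Subalgebra.algebraMap_mem _ c)
    · exact zero_mem _
  | grade1 x =>
    rw [gradeFree_g, AddMonoidAlgebra.coeff_single, Finsupp.single_apply]
    split_ifs with h
    · subst h
      exact gen_mem_rootSpace C q x
    · exact zero_mem _
  | mul x y hx hy =>
    rw [map_mul, AddMonoidAlgebra.coeff_mul]
    refine Submodule.sum_mem _ fun β _ => Submodule.sum_mem _ fun β' _ => ?_
    dsimp only
    split_ifs with h
    · rw [← h]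
      exact mul_mem_rootSpace C q hq (hx β) (hy β')
    · exact zero_mem _
  | add x y hx hy =>
    rw [map_add, AddMonoidAlgebra.coeff_add]
    exact add_mem (hx γ) (hy γ)

theorem sum_component (X : Uq C q) : ((grade C q X).coeff.sum fun _ Y => Y) = X := by
  let aug : AddMonoidAlgebra (Uq C q) (RootLattice n) →ₐ[ℂ] Uq C q :=
    AddMonoidAlgebra.liftNCAlgHom (AlgHom.id ℂ (Uq C q)) 1 fun _ _ => Commute.one_right _
  have haug : ∀ Y, aug Y = Y.coeff.sum fun _ Z => Z := fun Y => by
    simp [aug, AddMonoidAlgebra.liftNC, Finsupp.liftAddHom, AddMonoidHom.comp_apply]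
  rw [← haug]
  obtain ⟨x, rfl⟩ := Uq.mk_surjective C q X
  rw [grade_mk]
  have : aug.comp (gradeFree C q) = Uq.mk C q := by
    refine FreeAlgebra.hom_ext (funext fun x => ?_)
    change aug (gradeFree C q (g x)) = _
    rw [gradeFree_g, haug, AddMonoidAlgebra.coeff_single, Finsupp.sum_single_index rfl]
    rfl
  exact DFunLike.congr_fun this x

end Algebra

section Star

variable {n : ℕ} {C : CartanDatum n}

/-- The data of a `*`-structure: an involutive automorphism `η` of the Dynkin diagram and signs
`s_i` with `s_i = 1` whenever `η(i) ≠ i`. A Dynkin diagram automorphism preserves the Cartan matrix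
and the root lengths, i.e. the form `(·, ·)`. -/
structure StarDatum (C : CartanDatum n) where
  η : Equiv.Perm (Fin n)
  η_η : ∀ i, η (η i) = i
  map_A : ∀ i j, C.A (η i) (η j) = C.A i j
  map_d : ∀ i, C.d (η i) = C.d i
  s : Fin n → ℤˣ
  s_eq_one : ∀ i, η i ≠ i → s i = 1

/-- The sign `s_i` as a complex number. -/
def StarDatum.sgn (T : StarDatum C) (i : Fin n) : ℂ := ((T.s i : ℤ) : ℂ)

theorem StarDatum.sgn_mul_self (T : StarDatum C) (i : Fin n) : T.sgn i * T.sgn i = 1 := by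
  rcases Int.units_eq_one_or (T.s i) with h | h <;> simp [StarDatum.sgn, h]

theorem StarDatum.conj_sgn (T : StarDatum C) (i : Fin n) :
    starRingEnd ℂ (T.sgn i) = T.sgn i := by
  simp [StarDatum.sgn]

theorem StarDatum.sgn_η (T : StarDatum C) (i : Fin n) : T.sgn (T.η i) = T.sgn i := by
  by_cases h : T.η i = i
  · rw [h]
  · have h' : T.η (T.η i) ≠ T.η i := fun h' => h (T.η.injective h')
    simp [StarDatum.sgn, T.s_eq_one i h, T.s_eq_one _ h']

section Serre

variable {R : Type*} [Ring R] [Algebra ℂ R]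

theorem qBinom_symm (p : ℂ) {m r : ℕ} (h : r ≤ m) : qBinom p m (m - r) = qBinom p m r := by
  rw [qBinom, qBinom, Nat.sub_sub_self h, mul_comm]

theorem serre_reverse (p : ℂ) (m : ℕ) (x y : R) :
    ∑ r ∈ Finset.range (m + 1), ((-1) ^ r * qBinom p m r) • (x ^ r * y * x ^ (m - r)) =
      (-1 : ℂ) ^ m • serre p m x y := by
  rw [serre, Finset.smul_sum, ← Finset.sum_range_reflect]
  refine Finset.sum_congr rfl fun r hr => ?_
  have hr' : r ≤ m := Nat.lt_succ_iff.1 (Finset.mem_range.1 hr)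
  rw [show m + 1 - 1 - r = m - r by omega, Nat.sub_sub_self hr', qBinom_symm p hr', smul_smul,
    ← mul_assoc]
  congr 2
  obtain ⟨t, rfl⟩ := Nat.exists_eq_add_of_le hr'
  rw [Nat.add_sub_cancel_left, pow_add, mul_right_comm, ← mul_pow]
  simp

theorem serre_smul (p : ℂ) (m : ℕ) (a b : ℂ) (x y : R) :
    serre p m (a • x) (b • y) = (a ^ m * b) • serre p m x y := by
  rw [serre, serre, Finset.smul_sum]
  refine Finset.sum_congr rfl fun r hr => ?_
  have hr' : r ≤ m := Nat.lt_succ_iff.1 (Finset.mem_range.1 hr)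
  obtain ⟨t, rfl⟩ := Nat.exists_eq_add_of_le hr'
  rw [Nat.add_sub_cancel_left, smul_pow, smul_pow, smul_mul_smul_comm, smul_mul_smul_comm,
    smul_smul, smul_smul]
  congr 1
  ring

theorem pow_mul_of_qcomm {x k : R} {c : ℂ} (h : k * x = c • (x * k)) (a : ℕ) :
    k ^ a * x = c ^ a • (x * k ^ a) := by
  induction a with
  | zero => simp
  | succ a ih =>
    rw [pow_succ, mul_assoc, h, mul_smul_comm, ← mul_assoc, ih, smul_mul_assoc, smul_smul,
      mul_assoc, pow_succ, mul_comm c]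

theorem mul_pow_of_qcomm {x k : R} {c : ℂ} (h : k * x = c • (x * k)) (r : ℕ) :
    (x * k) ^ r = c ^ r.choose 2 • (x ^ r * k ^ r) := by
  induction r with
  | zero => simp
  | succ r ih =>
    have : x ^ r * k ^ r * (x * k) = c ^ r • (x ^ (r + 1) * k ^ (r + 1)) := by
      rw [mul_assoc, ← mul_assoc (k ^ r), pow_mul_of_qcomm h, smul_mul_assoc, mul_smul_comm,
        pow_succ, pow_succ]
      simp only [mul_assoc]
    rw [pow_succ, ih, smul_mul_assoc, this, smul_smul, ← pow_add,
      show (r + 1).choose 2 = r.choose 2 + r by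
        rw [Nat.choose_succ_succ' r 1, Nat.choose_one_right, add_comm]]

theorem monomial_of_qcomm {x y k l : R} {c e : ℂ} (hkx : k * x = c • (x * k))
    (hky : k * y = e • (y * k)) (hlx : l * x = e • (x * l)) (hkl : k * l = l * k) (r t : ℕ) :
    (x * k) ^ r * (y * l) * (x * k) ^ t =
      (c ^ (r + t).choose 2 * e ^ (r + t)) • (x ^ r * y * x ^ t * (k ^ (r + t) * l)) := by
  induction t with
  | zero =>
    have : x ^ r * k ^ r * (y * l) = e ^ r • (x ^ r * y * (k ^ r * l)) := by
      rw [mul_assoc, ← mul_assoc (k ^ r), pow_mul_of_qcomm hky, smul_mul_assoc, mul_smul_comm]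
      simp only [mul_assoc]
    rw [pow_zero, mul_one, pow_zero, mul_one, add_zero, mul_pow_of_qcomm hkx, smul_mul_assoc,
      this, smul_smul]
  | succ t ih =>
    have hkl' : l * k = k * l := hkl.symm
    have : k ^ (r + t) * l * (x * k) = (e * c ^ (r + t)) • (x * (k ^ (r + t + 1) * l)) := by
      rw [mul_assoc, ← mul_assoc l, hlx, smul_mul_assoc, mul_smul_comm, mul_assoc x, hkl',
        ← mul_assoc, pow_mul_of_qcomm hkx, smul_mul_assoc, smul_smul, pow_succ]
      simp only [mul_assoc]
    rw [pow_succ (x * k), ← mul_assoc, ih, smul_mul_assoc, mul_assoc _ _ (x * k), this,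
      mul_smul_comm, smul_smul, ← add_assoc, pow_succ x t,
      show (r + t + 1).choose 2 = (r + t).choose 2 + (r + t) by
        rw [Nat.choose_succ_succ' (r + t) 1, Nat.choose_one_right, add_comm]]
    congr 1
    · ring
    · simp only [mul_assoc]

theorem serre_of_qcomm {x y k l : R} {c e : ℂ} (hkx : k * x = c • (x * k))
    (hky : k * y = e • (y * k)) (hlx : l * x = e • (x * l)) (hkl : k * l = l * k)
    (p : ℂ) (m : ℕ) :
    serre p m (x * k) (y * l) =
      (c ^ m.choose 2 * e ^ m) • (serre p m x y * (k ^ m * l)) := by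
  rw [serre, serre, Finset.sum_mul, Finset.smul_sum]
  refine Finset.sum_congr rfl fun r hr => ?_
  have hr' : r ≤ m := Nat.lt_succ_iff.1 (Finset.mem_range.1 hr)
  rw [monomial_of_qcomm hkx hky hlx hkl, Nat.sub_add_cancel hr', smul_mul_assoc, smul_comm]

end Serre

section Relations

variable (C) (q : ℂ)

/-- `q^{(α_i, α_j)}`. -/
def qPair (i j : Fin n) : ℂ := qi C q i ^ C.A i j

theorem qPair_symm (i j : Fin n) : qPair C q i j = qPair C q j i := by
  rw [qPair, qPair, qi, qi, ← zpow_natCast, ← zpow_natCast, ← zpow_mul, ← zpow_mul, C.symm]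

theorem qPair_ne_zero (hq : q ≠ 0) (i j : Fin n) : qPair C q i j ≠ 0 :=
  zpow_ne_zero _ (pow_ne_zero _ hq)

theorem Uq.K_E (i j : Fin n) :
    Uq.K C q i * Uq.E C q j = qPair C q i j • (Uq.E C q j * Uq.K C q i) := by
  rw [← smul_mul_assoc, qPair, ← Uq.K_E_Kinv, mul_assoc _ _ (Uq.K C q i), Uq.Kinv_mul_K, mul_one]

theorem Uq.K_F (i j : Fin n) :
    Uq.K C q i * Uq.F C q j = (qPair C q i j)⁻¹ • (Uq.F C q j * Uq.K C q i) := by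
  rw [← smul_mul_assoc, qPair, ← zpow_neg, ← Uq.K_F_Kinv, mul_assoc _ _ (Uq.K C q i),
    Uq.Kinv_mul_K, mul_one]

theorem Kinv_qcomm {R : Type*} [Ring R] [Algebra ℂ R] {k k' x : R} {c : ℂ} (hc : c ≠ 0)
    (h1 : k * k' = 1) (h2 : k' * k = 1) (h : k * x = c • (x * k)) :
    k' * x = c⁻¹ • (x * k') := by
  have : x * k' = c • (k' * x) := by
    calc x * k' = k' * (k * x) * k' := by rw [← mul_assoc k', h2, one_mul]
      _ = c • (k' * x) := by
        rw [h, mul_smul_comm, smul_mul_assoc, mul_assoc, mul_assoc x, h1, mul_one]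
  rw [this, smul_smul, inv_mul_cancel₀ hc, one_smul]

theorem Uq.Kinv_E (hq : q ≠ 0) (i j : Fin n) :
    Uq.Kinv C q i * Uq.E C q j = (qPair C q i j)⁻¹ • (Uq.E C q j * Uq.Kinv C q i) :=
  Kinv_qcomm (qPair_ne_zero C q hq i j) (Uq.K_mul_Kinv C q i) (Uq.Kinv_mul_K C q i)
    (Uq.K_E C q i j)

theorem Uq.Kinv_F (hq : q ≠ 0) (i j : Fin n) :
    Uq.Kinv C q i * Uq.F C q j = qPair C q i j • (Uq.F C q j * Uq.Kinv C q i) := by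
  have := Kinv_qcomm (inv_ne_zero (qPair_ne_zero C q hq i j)) (Uq.K_mul_Kinv C q i)
    (Uq.Kinv_mul_K C q i) (Uq.K_F C q i j)
  rwa [inv_inv] at this

theorem Uq.Kinv_K_comm (i j : Fin n) :
    Uq.Kinv C q i * Uq.K C q j = Uq.K C q j * Uq.Kinv C q i :=
  commute_Kinv C q (Uq.K_mul_K C q i j)

theorem Uq.Kinv_Kinv (i j : Fin n) :
    Uq.Kinv C q i * Uq.Kinv C q j = Uq.Kinv C q j * Uq.Kinv C q i :=
  commute_Kinv C q (Uq.Kinv_K_comm C q j i).symm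

end Relations

section Construction

variable (T : StarDatum C) (q : ℝ)

/-- The values of the `*`-structure on the generators. -/
def starGen : Gen n → Uq C q
  | .E i => T.sgn i • (Uq.F C q (T.η i) * Uq.K C q (T.η i))
  | .F i => T.sgn i • (Uq.Kinv C q (T.η i) * Uq.E C q (T.η i))
  | .K i => Uq.K C q (T.η i)
  | .Kinv i => Uq.Kinv C q (T.η i)

/-- The opposite ring with scalars acting through complex conjugation. -/
abbrev conjOpAlgebra (R : Type*) [Ring R] [Algebra ℂ R] : Algebra ℂ Rᵐᵒᵖ :=
  Algebra.compHom Rᵐᵒᵖ (starRingEnd ℂ)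

/-- The conjugate-linear anti-multiplicative map on the free algebra with the prescribed values on
the generators. -/
def starFree : FreeGen n →+* (Uq C q)ᵐᵒᵖ :=
  letI := conjOpAlgebra (Uq C q)
  (FreeAlgebra.lift ℂ fun x => MulOpposite.op (starGen T q x)).toRingHom

theorem starFree_g (x : Gen n) : starFree T q (g x) = MulOpposite.op (starGen T q x) := by
  let _ := conjOpAlgebra (Uq C q)
  exact FreeAlgebra.lift_ι_apply _ _

theorem starFree_algebraMap (c : ℂ) :
    starFree T q (algebraMap ℂ _ c) = MulOpposite.op (algebraMap ℂ _ (starRingEnd ℂ c)) := by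
  let _ := conjOpAlgebra (Uq C q)
  exact AlgHom.commutes (FreeAlgebra.lift ℂ fun x => MulOpposite.op (starGen T q x)) c

theorem starFree_smul (c : ℂ) (x : FreeGen n) :
    starFree T q (c • x) = starRingEnd ℂ c • starFree T q x := by
  rw [Algebra.smul_def, map_mul, starFree_algebraMap, Algebra.smul_def]
  exact congrArg (· * starFree T q x) rfl

theorem conj_qi (i : Fin n) : starRingEnd ℂ (qi C q i) = qi C q i := by
  simp [qi]

theorem conj_qBinom {p : ℂ} (hp : starRingEnd ℂ p = p) (m r : ℕ) :
    starRingEnd ℂ (qBinom p m r) = qBinom p m r := by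
  simp [qBinom, qFact, qInt, map_prod, hp]

theorem qi_η (i : Fin n) : qi C q (T.η i) = qi C q i := by
  rw [qi, qi, T.map_d]

theorem qPair_η (i j : Fin n) : qPair C q (T.η i) (T.η j) = qPair C q i j := by
  rw [qPair, qPair, qi_η, T.map_A]

theorem conj_qPair (i j : Fin n) : starRingEnd ℂ (qPair C q i j) = qPair C q i j := by
  rw [qPair, map_zpow₀, conj_qi]

theorem starFree_serre {p : ℂ} (hp : starRingEnd ℂ p = p) (m : ℕ) (x y : Gen n) :
    starFree T q (serre p m (g x) (g y)) =
      MulOpposite.op ((-1 : ℂ) ^ m • serre p m (starGen T q x) (starGen T q y)) := by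
  apply MulOpposite.unop_injective
  rw [← serre_reverse, serre, map_sum, MulOpposite.unop_op, ← MulOpposite.opAddEquiv_symm_apply, map_sum]
  refine Finset.sum_congr rfl fun r _ => ?_
  simp only [starFree_smul, map_mul, map_pow, map_neg, map_one, starFree_g, conj_qBinom hp]
  rw [mul_assoc (_ ^ r)]
  rfl

theorem serre_starE (i j : Fin n) (h : i ≠ j) :
    serre (qi C q i) (serreDeg C i j) (starGen T q (.E i)) (starGen T q (.E j)) = 0 := by
  have h' : T.η i ≠ T.η j := fun e => h (T.η.injective e)
  have hs := Uq.serre_F C q _ _ h'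
  rw [qi_η, serreDeg, T.map_A] at hs
  have e := Uq.K_F C q (T.η j) (T.η i)
  rw [qPair_symm] at e
  rw [starGen, starGen, serre_smul, serre_of_qcomm (Uq.K_F C q (T.η i) (T.η i))
    (Uq.K_F C q (T.η i) (T.η j)) e (Uq.K_mul_K C q _ _), serreDeg, hs]
  simp

theorem serre_starF (hq : q ≠ 0) (i j : Fin n) (h : i ≠ j) :
    serre (qi C q i) (serreDeg C i j) (starGen T q (.F i)) (starGen T q (.F j)) = 0 := by
  have hq' : (q : ℂ) ≠ 0 := Complex.ofReal_ne_zero.2 hq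
  have h' : T.η i ≠ T.η j := fun e => h (T.η.injective e)
  have hs := Uq.serre_E C q _ _ h'
  rw [qi_η, serreDeg, T.map_A] at hs
  have e := Uq.Kinv_E C q hq' (T.η j) (T.η i)
  rw [qPair_symm] at e
  rw [starGen, starGen, Uq.Kinv_E C q hq' (T.η i) (T.η i), Uq.Kinv_E C q hq' (T.η j) (T.η j),
    smul_smul, smul_smul, serre_smul, serre_of_qcomm (Uq.Kinv_E C q hq' (T.η i) (T.η i))
    (Uq.Kinv_E C q hq' (T.η i) (T.η j)) e (Uq.Kinv_Kinv C q _ _), serreDeg, hs]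
  simp

theorem star_E_F_aux (hq : q ≠ 0) (a b : Fin n) :
    Uq.Kinv C q b * Uq.E C q b * (Uq.F C q a * Uq.K C q a) -
      Uq.F C q a * Uq.K C q a * (Uq.Kinv C q b * Uq.E C q b) =
    Uq.Kinv C q b * (Uq.E C q b * Uq.F C q a - Uq.F C q a * Uq.E C q b) * Uq.K C q a := by
  have hq' : (q : ℂ) ≠ 0 := Complex.ofReal_ne_zero.2 hq
  have hu := qPair_ne_zero C q hq' a b
  have h1 : Uq.F C q a * Uq.K C q a * (Uq.Kinv C q b * Uq.E C q b) =
      Uq.Kinv C q b * (Uq.F C q a * Uq.E C q b) * Uq.K C q a := by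
    calc Uq.F C q a * Uq.K C q a * (Uq.Kinv C q b * Uq.E C q b)
        = Uq.F C q a * Uq.Kinv C q b * (Uq.K C q a * Uq.E C q b) := by
          rw [mul_assoc, ← mul_assoc (Uq.K C q a), ← Uq.Kinv_K_comm]
          simp only [mul_assoc]
      _ = (qPair C q a b • (Uq.F C q a * Uq.Kinv C q b)) * (Uq.E C q b * Uq.K C q a) := by
          rw [Uq.K_E, mul_smul_comm, smul_mul_assoc]
      _ = _ := by
          rw [qPair_symm, ← Uq.Kinv_F C q hq' b a]
          simp only [mul_assoc]
  rw [h1, mul_sub, sub_mul]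
  simp only [mul_assoc]

theorem starFree_rel (hq : q ≠ 0) {x y : FreeGen n} (h : Rel C q x y) :
    starFree T q x = starFree T q y := by
  have hq' : (q : ℂ) ≠ 0 := Complex.ofReal_ne_zero.2 hq
  apply MulOpposite.unop_injective
  cases h with
  | K_Kinv i =>
    simp only [map_mul, map_one, starFree_g, MulOpposite.unop_mul, MulOpposite.unop_op,
      MulOpposite.unop_one]
    exact Uq.Kinv_mul_K C q _
  | Kinv_K i =>
    simp only [map_mul, map_one, starFree_g, MulOpposite.unop_mul, MulOpposite.unop_op,
      MulOpposite.unop_one]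
    exact Uq.K_mul_Kinv C q _
  | K_comm i j =>
    simp only [map_mul, starFree_g, MulOpposite.unop_mul, MulOpposite.unop_op]
    exact Uq.K_mul_K C q _ _
  | K_E i j =>
    rw [starFree_smul, ← qPair, conj_qPair]
    simp only [map_mul, starFree_g, MulOpposite.unop_mul, MulOpposite.unop_op,
      MulOpposite.unop_smul, starGen]
    rw [smul_mul_assoc, mul_smul_comm, smul_comm, mul_assoc (Uq.F C q _), Uq.K_mul_K,
      ← mul_assoc (Uq.F C q _), ← mul_assoc, ← mul_assoc, Uq.Kinv_F C q hq', qPair_η,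
      smul_mul_assoc, smul_mul_assoc, mul_assoc (Uq.F C q _), Uq.Kinv_mul_K, mul_one]
  | K_F i j =>
    rw [starFree_smul, zpow_neg, ← qPair, map_inv₀, conj_qPair]
    simp only [map_mul, starFree_g, MulOpposite.unop_mul, MulOpposite.unop_op,
      MulOpposite.unop_smul, starGen]
    rw [smul_mul_assoc, mul_smul_comm, smul_comm, ← mul_assoc (Uq.Kinv C q _),
      ← mul_assoc (Uq.Kinv C q _), Uq.Kinv_Kinv, mul_assoc (Uq.Kinv C q _),
      Uq.Kinv_E C q hq', qPair_η, mul_smul_comm, smul_mul_assoc]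
    simp only [mul_assoc]
    rw [Uq.Kinv_mul_K, mul_one]
  | E_F_same i =>
    have hc : starRingEnd ℂ (qi C q i - (qi C q i)⁻¹)⁻¹ = (qi C q i - (qi C q i)⁻¹)⁻¹ := by
      simp [conj_qi]
    rw [starFree_smul, hc]
    simp only [map_mul, map_sub, starFree_g, MulOpposite.unop_mul, MulOpposite.unop_op,
      MulOpposite.unop_smul, MulOpposite.unop_sub, starGen]
    rw [smul_mul_smul_comm, smul_mul_smul_comm, T.sgn_mul_self, one_smul, one_smul,
      star_E_F_aux q hq, Uq.E_F_same, qi_η, mul_smul_comm, smul_mul_assoc, mul_sub,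
      Uq.Kinv_mul_K, sub_mul, one_mul, mul_assoc, Uq.Kinv_mul_K, mul_one]
  | E_F_diff i j h =>
    have h' : T.η j ≠ T.η i := fun e => h (T.η.injective e).symm
    simp only [map_mul, map_sub, map_zero, starFree_g, MulOpposite.unop_mul,
      MulOpposite.unop_op, MulOpposite.unop_zero, MulOpposite.unop_sub, starGen]
    rw [smul_mul_smul_comm, smul_mul_smul_comm, mul_comm (T.sgn j), ← smul_sub,
      star_E_F_aux q hq, Uq.E_F_diff C q _ _ h', mul_zero, zero_mul, smul_zero]
  | serre_E i j h =>
    rw [starFree_serre T q (conj_qi q i), serre_starE T q i j h]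
    simp
  | serre_F i j h =>
    rw [starFree_serre T q (conj_qi q i), serre_starF T q hq i j h]
    simp

/-- The `*`-structure on `U_q(𝔤)`, for real `q ≠ 0`, as a ring homomorphism to the opposite
ring. -/
def starHom (hq : q ≠ 0) : Uq C q →+* (Uq C q)ᵐᵒᵖ :=
  RingQuot.lift ⟨starFree T q, fun _ _ h => starFree_rel T q hq h⟩

/-- The `*`-structure on `U_q(𝔤)` determined by `η` and `s`, for real `q ≠ 0`: the conjugate-linear
anti-multiplicative involution with `K_i^* = K_{η(i)}`, `E_i^* = s_i F_{η(i)} K_{η(i)}` and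
`F_i^* = s_i K_{η(i)}⁻¹ E_{η(i)}`. -/
def qStar (hq : q ≠ 0) (X : Uq C q) : Uq C q := (starHom T q hq X).unop

variable (hq : q ≠ 0)

theorem qStar_mk (x : FreeGen n) : qStar T q hq (Uq.mk C q x) = (starFree T q x).unop := by
  have : Uq.mk C q x = RingQuot.mkRingHom (Rel C q) x := by
    rw [← RingQuot.mkAlgHom_coe ℂ (Rel C q)]; rfl
  rw [this]
  exact congrArg MulOpposite.unop (RingQuot.lift_mkRingHom_apply _ _ x)

theorem qStar_K (i : Fin n) : qStar T q hq (Uq.K C q i) = Uq.K C q (T.η i) := by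
  rw [Uq.K, qStar_mk, starFree_g]; rfl

theorem qStar_Kinv (i : Fin n) : qStar T q hq (Uq.Kinv C q i) = Uq.Kinv C q (T.η i) := by
  rw [Uq.Kinv, qStar_mk, starFree_g]; rfl

theorem qStar_E (i : Fin n) :
    qStar T q hq (Uq.E C q i) = T.sgn i • (Uq.F C q (T.η i) * Uq.K C q (T.η i)) := by
  rw [Uq.E, qStar_mk, starFree_g]; rfl

theorem qStar_F (i : Fin n) :
    qStar T q hq (Uq.F C q i) = T.sgn i • (Uq.Kinv C q (T.η i) * Uq.E C q (T.η i)) := by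
  rw [Uq.F, qStar_mk, starFree_g]; rfl

theorem qStar_add (X Y : Uq C q) :
    qStar T q hq (X + Y) = qStar T q hq X + qStar T q hq Y := by
  simp [qStar]

theorem qStar_mul (X Y : Uq C q) :
    qStar T q hq (X * Y) = qStar T q hq Y * qStar T q hq X := by
  simp [qStar]

theorem qStar_smul (c : ℂ) (X : Uq C q) :
    qStar T q hq (c • X) = starRingEnd ℂ c • qStar T q hq X := by
  obtain ⟨x, rfl⟩ := Uq.mk_surjective C q X
  rw [← map_smul, qStar_mk, qStar_mk, starFree_smul]
  rfl

theorem qStar_one : qStar T q hq 1 = 1 := by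
  simp [qStar]

theorem qStar_qStar (X : Uq C q) : qStar T q hq (qStar T q hq X) = X := by
  obtain ⟨x, rfl⟩ := Uq.mk_surjective C q X
  induction x using FreeAlgebra.induction with
  | grade0 c =>
    rw [AlgHom.commutes, Algebra.algebraMap_eq_smul_one, qStar_smul, qStar_smul, qStar_one,
      qStar_one, Complex.conj_conj]
  | grade1 x =>
    cases x with
    | E i =>
      change qStar T q hq (qStar T q hq (Uq.E C q i)) = Uq.E C q i
      rw [qStar_E, qStar_smul, qStar_mul, qStar_F, qStar_K, T.conj_sgn, T.η_η, T.sgn_η,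
        mul_smul_comm, smul_smul, T.sgn_mul_self, one_smul, ← mul_assoc, Uq.K_mul_Kinv, one_mul]
    | F i =>
      change qStar T q hq (qStar T q hq (Uq.F C q i)) = Uq.F C q i
      rw [qStar_F, qStar_smul, qStar_mul, qStar_E, qStar_Kinv, T.conj_sgn, T.η_η, T.sgn_η,
        smul_mul_assoc, smul_smul, T.sgn_mul_self, one_smul, mul_assoc, Uq.K_mul_Kinv, mul_one]
    | K i =>
      change qStar T q hq (qStar T q hq (Uq.K C q i)) = Uq.K C q i
      rw [qStar_K, qStar_K, T.η_η]
    | Kinv i =>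
      change qStar T q hq (qStar T q hq (Uq.Kinv C q i)) = Uq.Kinv C q i
      rw [qStar_Kinv, qStar_Kinv, T.η_η]
  | mul x y hx hy => rw [map_mul, qStar_mul, qStar_mul, hx, hy]
  | add x y hx hy => rw [map_add, qStar_add, qStar_add, hx, hy]

end Construction

end Star

section Mathieu

variable {n : ℕ} (C : CartanDatum n) (q : ℂ)

section Induced

variable (V : Type*) [AddCommGroup V] [Module ℂ V] [Module (Uzero C q) V]
  [IsScalarTower ℂ (Uzero C q) V]

/-- The relations `XZ ⊗ v = X ⊗ Zv`, `Z ∈ U_0`, in `U_q(𝔤) ⊗_ℂ V`. -/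
def balanced : Submodule (Uq C q) (Uq C q ⊗[ℂ] V) :=
  Submodule.span (Uq C q)
    {t | ∃ (X : Uq C q) (Z : Uzero C q) (v : V),
      t = (X * (Z : Uq C q)) ⊗ₜ[ℂ] v - X ⊗ₜ[ℂ] (Z • v)}

/-- The induced module `M(V) = U_q(𝔤) ⊗_{U_0} V`. -/
def Mathieu : Type _ := (Uq C q ⊗[ℂ] V) ⧸ balanced C q V

instance : AddCommGroup (Mathieu C q V) :=
  inferInstanceAs (AddCommGroup ((Uq C q ⊗[ℂ] V) ⧸ balanced C q V))

instance : Module (Uq C q) (Mathieu C q V) :=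
  inferInstanceAs (Module (Uq C q) ((Uq C q ⊗[ℂ] V) ⧸ balanced C q V))

instance : Module ℂ (Mathieu C q V) :=
  inferInstanceAs (Module ℂ ((Uq C q ⊗[ℂ] V) ⧸ balanced C q V))

instance : IsScalarTower ℂ (Uq C q) (Mathieu C q V) :=
  inferInstanceAs (IsScalarTower ℂ (Uq C q) ((Uq C q ⊗[ℂ] V) ⧸ balanced C q V))

/-- The element `X ⊗ v` of `M(V)`. -/
def Mathieu.tmul (X : Uq C q) (v : V) : Mathieu C q V :=
  Submodule.Quotient.mk (X ⊗ₜ[ℂ] v)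

end Induced

variable {C q}

/-- The one-dimensional `U_0`-module defined by a character `φ` of `U_0`: the space `ℂ` with
`Z • c = φ(Z) c`. -/
def OneDim (_φ : Uzero C q →ₐ[ℂ] ℂ) : Type := ℂ

instance (φ : Uzero C q →ₐ[ℂ] ℂ) : AddCommGroup (OneDim φ) := inferInstanceAs (AddCommGroup ℂ)

instance (φ : Uzero C q →ₐ[ℂ] ℂ) : Module ℂ (OneDim φ) := inferInstanceAs (Module ℂ ℂ)

instance (φ : Uzero C q →ₐ[ℂ] ℂ) : Module (Uzero C q) (OneDim φ) :=
  Module.compHom ℂ (φ : Uzero C q →+* ℂ)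

theorem OneDim.smul_def (φ : Uzero C q →ₐ[ℂ] ℂ) (Z : Uzero C q) (c : ℂ) :
    (Z • (show OneDim φ from c) : OneDim φ) = (φ Z * c : ℂ) := rfl

instance (φ : Uzero C q →ₐ[ℂ] ℂ) : IsScalarTower ℂ (Uzero C q) (OneDim φ) where
  smul_assoc a Z c := by
    change φ (a • Z) * (show ℂ from c) = a * (φ Z * (show ℂ from c))
    rw [map_smul, smul_eq_mul, mul_assoc]

/-- The generator `1 ⊗ 1` of the rank one module `M(ℂ_φ)`. -/
def vac (φ : Uzero C q →ₐ[ℂ] ℂ) : Mathieu C q (OneDim φ) :=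
  Mathieu.tmul C q (OneDim φ) 1 (1 : ℂ)

/-- The product `E_i F_i` as an element of `U_0`. -/
def EF (C : CartanDatum n) (q : ℂ) (hq : q ≠ 0) (i : Fin n) : Uzero C q :=
  ⟨Uq.E C q i * Uq.F C q i, mem_Uzero_of_commute C q fun j => by
    rw [← mul_assoc, Uq.K_E, smul_mul_assoc, mul_assoc, Uq.K_F, mul_smul_comm, smul_smul,
      mul_inv_cancel₀ (qPair_ne_zero C q hq j i), one_smul, mul_assoc]⟩

/-- `φ` is the one-dimensional representation `φ^S_{λ,μ}` of `U_0`: it restricts to `λ` on `U⁰`,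
sends `E_i F_i` to `μ_i` for `i ∈ S`, and vanishes on `I^S`. -/
structure IsRankOneRep (hq : q ≠ 0) (S : Finset (Fin n)) (lam : Ucartan C q →ₐ[ℂ] ℂ) (mu : S → ℂ)
    (φ : Uzero C q →ₐ[ℂ] ℂ) : Prop where
  cartan : φ.comp (Subalgebra.inclusion (Ucartan_le_Uzero C q)) = lam
  EF : ∀ i : S, φ (EF C q hq i) = mu i
  ideal : ∀ X : Uzero C q, (X : Uq C q) ∈ idealI C q S → φ X = 0

/-- The extension of `φ : U_0 → ℂ` to a linear functional on `U_q(𝔤) = ⨁_γ U_γ`, by first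
projecting onto `U_0`. -/
def extend (hq : q ≠ 0) (φ : Uzero C q →ₐ[ℂ] ℂ) : Uq C q →ₗ[ℂ] ℂ :=
  φ.toLinearMap ∘ₗ (component C q 0).codRestrict (Subalgebra.toSubmodule (Uzero C q))
    fun X => (mem_Uzero_iff C q).2 (component_mem_rootSpace C q hq X 0)

end Mathieu

section Unitary

variable {n : ℕ} {C : CartanDatum n} (T : StarDatum C) {q : ℝ} (hq : q ≠ 0)

/-- Positivity of a linear functional on the `*`-algebra `U_q(𝔤)`. -/
def IsPositiveFunctional (f : Uq C q →ₗ[ℂ] ℂ) : Prop :=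
  ∀ X : Uq C q, 0 ≤ f (qStar T q hq X * X)

/-- An inner product on a `U_q(𝔤)`-module `W` makes it unitary if
`⟨X u, w⟩ = ⟨u, X^* w⟩` for all `X`. -/
def IsUnitary {W : Type*} [AddCommGroup W] [Module ℂ W] [Module (Uq C q) W]
    (ip : InnerProductSpace.Core ℂ W) : Prop :=
  ∀ (X : Uq C q) (u w : W), ip.inner (X • u) w = ip.inner u (qStar T q hq X • w)

/-- The set `N = {X • (1 ⊗ 1) | φ(X^* X) = 0}`. -/
def nullSet (φ : Uzero C (q : ℂ) →ₐ[ℂ] ℂ) : Set (Mathieu C q (OneDim φ)) :=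
  {m | ∃ X : Uq C q, m = X • vac φ ∧
    extend (Complex.ofReal_ne_zero.2 hq) φ (qStar T q hq X * X) = 0}

end Unitary

end QuantumMathieu

end

/-!
Let `f` be the extension of `φ` to `U = U_q(𝔤)` through the projection onto `U_0`.

The weights of `U` are separated: if all `q^{(α_i, γ)}` are `1`, then all `(α_i, γ)` vanish, because
`q` is not a root of unity, and `γ = 0`, because the form is positive definite
(`eq_zero_of_forall_zpow_pair_eq_one`). Hence elements of `U_0` are homogeneous of degree `0`
(`component_zero_eq_self`), which gives `f (X Z) = f X φ(Z)` for `Z ∈ U_0` (`extend_mul`). So `f`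
factors through `X ↦ X • (1 ⊗ 1)` (`extend_eq_zero_of_smul_vac_eq_zero`), and
`{X • (1 ⊗ 1) | ∀ Y, f (Y X) = 0}` is a `U`-submodule of `M`, called `radical`.

The radical is a maximal submodule whether or not `f` is positive. A submodule `W` of `M` is stable
under the projections to weight spaces, since it is stable under the `K_i`
(`component_zero_smul_vac_mem`). The weight space of `1 ⊗ 1` is the line through `1 ⊗ 1`, and the
coefficient of `X • (1 ⊗ 1)` along it is `f X`. So either `W` contains `1 ⊗ 1`, which generates `M`,
or `f (Y X) = 0` for all `X • (1 ⊗ 1) ∈ W` and all `Y`, that is, `W` is contained in the radical.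

When `f` is positive, `f (Y^* X)` is a positive semidefinite Hermitian form. By the Cauchy–Schwarz
inequality its null vectors are exactly the `X` with `f (Y X) = 0` for all `Y`, so that the null
set is the radical and the form descends to an inner product on the quotient.
-/

noncomputable section

namespace QuantumMathieu

/-! ### Homogeneous components -/

section Components

variable {n : ℕ} (C : CartanDatum n) (q : ℂ)

theorem CartanDatum.eq_zero_of_forall_pair_eq_zero {γ : RootLattice n}
    (h : ∀ i, C.pair i γ = 0) : γ = 0 := by
  by_contra hγ
  have hx : (fun j => (γ j : ℝ)) ≠ 0 := fun e => hγ <| funext fun j => by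
    simpa using congrFun e j
  have hpos := C.posDef.dotProduct_mulVec_pos hx
  have hz : (Matrix.of fun i j => ((C.d i : ℝ) * (C.A i j : ℝ))).mulVec
      (fun j => (γ j : ℝ)) = 0 := by
    funext i
    have := congrArg (Int.cast : ℤ → ℝ) (h i)
    simpa [CartanDatum.pair, Matrix.mulVec, dotProduct] using this
  rw [hz, dotProduct_zero] at hpos
  exact lt_irrefl _ hpos

theorem eq_zero_of_zpow_eq_one {q : ℂ} (hroot : ∀ k : ℕ, 0 < k → q ^ k ≠ 1) {m : ℤ}
    (h : q ^ m = 1) : m = 0 := by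
  by_contra hm
  refine hroot m.natAbs (Int.natAbs_pos.2 hm) ?_
  rcases Int.natAbs_eq m with e | e <;> rw [e] at h
  · rwa [zpow_natCast] at h
  · rwa [zpow_neg, zpow_natCast, inv_eq_one] at h

theorem eq_zero_of_forall_zpow_pair_eq_one (hroot : ∀ k : ℕ, 0 < k → q ^ k ≠ 1)
    {γ : RootLattice n} (h : ∀ i, q ^ C.pair i γ = 1) : γ = 0 :=
  C.eq_zero_of_forall_pair_eq_zero fun i => eq_zero_of_zpow_eq_one hroot (h i)

theorem component_K_mul_mul_Kinv (hq : q ≠ 0) (X : Uq C q) (i : Fin n) (γ : RootLattice n) :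
    component C q γ (Uq.K C q i * X * Uq.Kinv C q i) =
      q ^ C.pair i γ • component C q γ X := by
  have hK : grade C q (Uq.K C q i) = AddMonoidAlgebra.single 0 (Uq.K C q i) := by
    rw [Uq.K, grade_mk, gradeFree_g]; rfl
  have hKinv : grade C q (Uq.Kinv C q i) = AddMonoidAlgebra.single 0 (Uq.Kinv C q i) := by
    rw [Uq.Kinv, grade_mk, gradeFree_g]; rfl
  rw [← component_mem_rootSpace C q hq X γ i]
  change (grade C q (Uq.K C q i * X * Uq.Kinv C q i)).coeff γ = _
  rw [map_mul, map_mul, hK, hKinv, AddMonoidAlgebra.coeff_mul_single_zero,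
    AddMonoidAlgebra.coeff_single_zero_mul]
  rfl

/-- An element all of whose components of nonzero degree vanish is homogeneous of degree `0`. -/
theorem component_zero_eq_self_of_forall {X : Uq C q}
    (h : ∀ γ, γ ≠ 0 → component C q γ X = 0) : component C q 0 X = X := by
  conv_rhs => rw [← sum_component C q X]
  rw [Finsupp.sum]
  by_cases h0 : (0 : RootLattice n) ∈ (grade C q X).coeff.support
  · exact (Finset.sum_eq_single_of_mem 0 h0 fun γ _ hγ => h γ hγ).symm
  · exact (Finsupp.notMem_support_iff.1 h0).trans
      (Finset.sum_eq_zero fun γ hγ => h γ fun e => h0 (e ▸ hγ)).symm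

theorem component_eq_zero_of_mem_Uzero (hq : q ≠ 0) (hroot : ∀ k : ℕ, 0 < k → q ^ k ≠ 1)
    {Z : Uq C q} (hZ : Z ∈ Uzero C q) {γ : RootLattice n} (hγ : γ ≠ 0) :
    component C q γ Z = 0 := by
  by_contra hne
  refine hγ (eq_zero_of_forall_zpow_pair_eq_one C q hroot fun i => ?_)
  have h := component_K_mul_mul_Kinv C q hq Z i γ
  rw [(mem_Uzero_iff C q).1 hZ i] at h
  have h0 : C.pair i 0 = 0 := by simp [CartanDatum.pair]
  rw [h0, zpow_zero, one_smul] at h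
  have : (1 - q ^ C.pair i γ) • component C q γ Z = 0 := by
    rw [sub_smul, one_smul, ← h, sub_self]
  exact (sub_eq_zero.1 ((smul_eq_zero.1 this).resolve_right hne)).symm

theorem component_zero_eq_self (hq : q ≠ 0) (hroot : ∀ k : ℕ, 0 < k → q ^ k ≠ 1)
    {Z : Uq C q} (hZ : Z ∈ Uzero C q) : component C q 0 Z = Z :=
  component_zero_eq_self_of_forall C q fun _ hγ =>
    component_eq_zero_of_mem_Uzero C q hq hroot hZ hγ

theorem grade_of_mem_Uzero (hq : q ≠ 0) (hroot : ∀ k : ℕ, 0 < k → q ^ k ≠ 1)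
    {Z : Uq C q} (hZ : Z ∈ Uzero C q) : grade C q Z = AddMonoidAlgebra.single 0 Z := by
  ext γ
  by_cases hγ : γ = 0
  · subst hγ
    rw [AddMonoidAlgebra.coeff_single, Finsupp.single_eq_same]
    exact component_zero_eq_self C q hq hroot hZ
  · rw [AddMonoidAlgebra.coeff_single, Finsupp.single_eq_of_ne hγ]
    exact component_eq_zero_of_mem_Uzero C q hq hroot hZ hγ

theorem component_zero_mul (hq : q ≠ 0) (hroot : ∀ k : ℕ, 0 < k → q ^ k ≠ 1)
    (X : Uq C q) {Z : Uq C q} (hZ : Z ∈ Uzero C q) :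
    component C q 0 (X * Z) = component C q 0 X * Z := by
  change (grade C q (X * Z)).coeff 0 = _
  rw [map_mul, grade_of_mem_Uzero C q hq hroot hZ, AddMonoidAlgebra.coeff_mul_single_zero]
  rfl

/-- A subspace of `U_q(𝔤)` stable under conjugation by the `K_i` is stable under the projection
onto `U_0`. -/
theorem component_zero_mem (hq : q ≠ 0) (hroot : ∀ k : ℕ, 0 < k → q ^ k ≠ 1)
    (J : Submodule ℂ (Uq C q))
    (hJ : ∀ X ∈ J, ∀ i, Uq.K C q i * X * Uq.Kinv C q i ∈ J) {X : Uq C q} (hX : X ∈ J) :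
    component C q 0 X ∈ J := by
  have key : ∀ (s : Finset (RootLattice n)) (X : Uq C q), X ∈ J →
      (∀ γ, γ ≠ 0 → γ ∉ s → component C q γ X = 0) → component C q 0 X ∈ J := by
    intro s
    induction s using Finset.induction_on with
    | empty =>
      intro X hX h
      rwa [component_zero_eq_self_of_forall C q fun γ hγ => h γ hγ (Finset.notMem_empty γ)]
    | insert β s _ ih =>
      intro X hX h
      by_cases hβ : β = 0
      · exact ih X hX fun γ hγ hs => h γ hγ (by simp [hγ, hs, hβ])
      obtain ⟨i, hi⟩ : ∃ i, q ^ C.pair i β ≠ 1 := by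
        by_contra! hall
        exact hβ (eq_zero_of_forall_zpow_pair_eq_one C q hroot hall)
      -- Subtracting the eigenvalue at `β` removes the component of degree `β` and multiplies the
      -- component of degree `0` by a nonzero scalar.
      set Y := Uq.K C q i * X * Uq.Kinv C q i - q ^ C.pair i β • X with hYdef
      have hcomp : ∀ γ, component C q γ Y =
          (q ^ C.pair i γ - q ^ C.pair i β) • component C q γ X := fun γ => by
        rw [hYdef, map_sub, map_smul, component_K_mul_mul_Kinv C q hq, sub_smul]
      have hY : Y ∈ J := J.sub_mem (hJ X hX i) (J.smul_mem _ hX)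
      have h0 := ih Y hY fun γ hγ hs => by
        rw [hcomp]
        by_cases e : γ = β
        · rw [e, sub_self, zero_smul]
        · rw [h γ hγ (by simp [e, hs]), smul_zero]
      have hp0 : C.pair i 0 = 0 := by simp [CartanDatum.pair]
      rw [hcomp, hp0, zpow_zero] at h0
      exact (J.smul_mem_iff (sub_ne_zero.2 hi.symm)).1 h0
  exact key (grade C q X).coeff.support X hX fun γ _ hs => Finsupp.notMem_support_iff.1 hs

end Components

/-! ### The induced module -/

section Induced

variable {n : ℕ} {C : CartanDatum n} {q : ℂ} (hq : q ≠ 0) (φ : Uzero C q →ₐ[ℂ] ℂ)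

theorem extend_mul (hroot : ∀ k : ℕ, 0 < k → q ^ k ≠ 1) (X : Uq C q) (Z : Uzero C q) :
    extend hq φ (X * Z) = extend hq φ X * φ Z := by
  simp only [extend, LinearMap.comp_apply, AlgHom.toLinearMap_apply]
  rw [← map_mul]
  congr 1
  exact Subtype.ext (component_zero_mul C q hq hroot X Z.2)

theorem extend_one (hroot : ∀ k : ℕ, 0 < k → q ^ k ≠ 1) : extend hq φ 1 = 1 := by
  rw [extend, LinearMap.comp_apply, AlgHom.toLinearMap_apply, ← map_one φ]
  congr 1
  exact Subtype.ext (component_zero_eq_self C q hq hroot (one_mem _))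

variable (C q) in
theorem Mathieu.smul_tmul {V : Type*} [AddCommGroup V] [Module ℂ V] [Module (Uzero C q) V]
    [IsScalarTower ℂ (Uzero C q) V] (Y X : Uq C q) (v : V) :
    Y • Mathieu.tmul C q V X v = Mathieu.tmul C q V (Y * X) v :=
  congrArg (Submodule.Quotient.mk (p := balanced C q V)) (TensorProduct.smul_tmul' Y X v)

variable (C q) in
theorem Mathieu.tmul_coe_smul {V : Type*} [AddCommGroup V] [Module ℂ V] [Module (Uzero C q) V]
    [IsScalarTower ℂ (Uzero C q) V] (X : Uq C q) (Z : Uzero C q) (v : V) :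
    Mathieu.tmul C q V (X * Z) v = Mathieu.tmul C q V X (Z • v) :=
  (Submodule.Quotient.eq (balanced C q V)).2 (Submodule.subset_span ⟨X, Z, v, rfl⟩)

variable (C q) in
theorem Mathieu.tmul_smul {V : Type*} [AddCommGroup V] [Module ℂ V] [Module (Uzero C q) V]
    [IsScalarTower ℂ (Uzero C q) V] (c : ℂ) (X : Uq C q) (v : V) :
    Mathieu.tmul C q V X (c • v) = Mathieu.tmul C q V (c • X) v :=
  congrArg (Submodule.Quotient.mk (p := balanced C q V)) (TensorProduct.smul_tmul c X v).symm

/-- The number `1` as a vector of the one-dimensional module `ℂ_φ`. -/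
def OneDim.unit : OneDim φ := (1 : ℂ)

theorem OneDim.coe_smul_unit (Z : Uzero C q) : Z • OneDim.unit φ = φ Z • OneDim.unit φ := rfl

theorem OneDim.exists_eq_smul_unit (v : OneDim φ) : ∃ c : ℂ, v = c • OneDim.unit φ :=
  ⟨v, (mul_one (show ℂ from v)).symm⟩

theorem smul_vac (X : Uq C q) : X • vac φ = Mathieu.tmul C q (OneDim φ) X (OneDim.unit φ) :=
  (Mathieu.smul_tmul C q X 1 (OneDim.unit φ)).trans (by rw [mul_one])

theorem exists_smul_vac (m : Mathieu C q (OneDim φ)) : ∃ X : Uq C q, m = X • vac φ := by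
  obtain ⟨t, rfl⟩ := Submodule.Quotient.mk_surjective (balanced C q (OneDim φ)) m
  induction t using TensorProduct.induction_on with
  | zero => exact ⟨0, by rw [zero_smul]; rfl⟩
  | tmul X v =>
    obtain ⟨c, rfl⟩ := OneDim.exists_eq_smul_unit φ v
    exact ⟨c • X, (Mathieu.tmul_smul C q c X _).trans (smul_vac φ _).symm⟩
  | add s t hs ht =>
    obtain ⟨X, hX⟩ := hs
    obtain ⟨Y, hY⟩ := ht
    exact ⟨X + Y, by rw [add_smul, ← hX, ← hY]; rfl⟩

theorem coe_smul_vac (Z : Uzero C q) : (Z : Uq C q) • vac φ = (φ Z • (1 : Uq C q)) • vac φ := by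
  rw [smul_vac, ← one_mul (Z : Uq C q), Mathieu.tmul_coe_smul, OneDim.coe_smul_unit,
    Mathieu.tmul_smul, smul_vac]

/-- The functional `X ⊗ c ↦ c f(X)` on `U_q(𝔤) ⊗_ℂ ℂ_φ`, where `f` is the extension of `φ`. -/
def tensorFunctional : Uq C q ⊗[ℂ] OneDim φ →ₗ[ℂ] ℂ :=
  TensorProduct.lift ((LinearMap.mul ℂ ℂ).comp (extend hq φ) :
    Uq C q →ₗ[ℂ] OneDim φ →ₗ[ℂ] ℂ)

theorem tensorFunctional_tmul (X : Uq C q) (v : OneDim φ) :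
    tensorFunctional hq φ (X ⊗ₜ v) = extend hq φ X * (show ℂ from v) := rfl

theorem tensorFunctional_eq_zero (hroot : ∀ k : ℕ, 0 < k → q ^ k ≠ 1)
    {t : Uq C q ⊗[ℂ] OneDim φ} (ht : t ∈ balanced C q (OneDim φ)) :
    tensorFunctional hq φ t = 0 := by
  suffices h : ∀ Y : Uq C q, tensorFunctional hq φ (Y • t) = 0 by
    simpa using h 1
  rw [balanced] at ht
  induction ht using Submodule.span_induction with
  | mem t ht =>
    obtain ⟨X, Z, v, rfl⟩ := ht
    intro Y
    rw [smul_sub, map_sub, TensorProduct.smul_tmul', TensorProduct.smul_tmul',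
      tensorFunctional_tmul, tensorFunctional_tmul, smul_eq_mul, smul_eq_mul, ← mul_assoc,
      extend_mul hq φ hroot, mul_assoc]
    exact sub_self _
  | zero => simp
  | add s t _ _ hs ht =>
    intro Y
    rw [smul_add, map_add, hs, ht, add_zero]
  | smul X t _ ht =>
    intro Y
    rw [smul_smul, ht]

theorem extend_eq_zero_of_smul_vac_eq_zero (hroot : ∀ k : ℕ, 0 < k → q ^ k ≠ 1)
    {X : Uq C q} (h : X • vac φ = 0) : extend hq φ X = 0 := by
  rw [smul_vac] at h
  exact (mul_one _).symm.trans
    (tensorFunctional_eq_zero hq φ hroot ((Submodule.Quotient.mk_eq_zero _).1 h))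

/-- The submodule `{X • (1 ⊗ 1) | f(Y X) = 0 for all Y}` of the rank one module, where `f` is the
extension of `φ`. -/
def radical : Submodule (Uq C q) (Mathieu C q (OneDim φ)) where
  carrier := {m | ∃ X : Uq C q, m = X • vac φ ∧ ∀ Y, extend hq φ (Y * X) = 0}
  zero_mem' := ⟨0, (zero_smul _ _).symm, fun Y => by simp⟩
  add_mem' := by
    rintro _ _ ⟨X, rfl, hX⟩ ⟨X', rfl, hX'⟩
    exact ⟨X + X', (add_smul _ _ _).symm, fun Y => by rw [mul_add, map_add, hX, hX', add_zero]⟩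
  smul_mem' := by
    rintro Z _ ⟨X, rfl, hX⟩
    exact ⟨Z * X, smul_smul _ _ _, fun Y => by rw [← mul_assoc, hX]⟩

theorem smul_vac_mem_radical (hroot : ∀ k : ℕ, 0 < k → q ^ k ≠ 1) {X : Uq C q} :
    X • vac φ ∈ radical hq φ ↔ ∀ Y, extend hq φ (Y * X) = 0 := by
  refine ⟨?_, fun h => ⟨X, rfl, h⟩⟩
  rintro ⟨X', hX', h⟩ Y
  have := extend_eq_zero_of_smul_vac_eq_zero hq φ hroot (X := Y * (X - X'))
    (by rw [mul_smul, sub_smul, hX', sub_self, smul_zero])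
  rwa [mul_sub, map_sub, h, sub_zero] at this

/-- Submodules of the rank one module are stable under the projection to the weight space of
`1 ⊗ 1`. -/
theorem component_zero_smul_vac_mem (hq : q ≠ 0) (hroot : ∀ k : ℕ, 0 < k → q ^ k ≠ 1)
    (W : Submodule (Uq C q) (Mathieu C q (OneDim φ))) {X : Uq C q} (hX : X • vac φ ∈ W) :
    component C q 0 X • vac φ ∈ W := by
  let J : Submodule ℂ (Uq C q) :=
    { carrier := {X | X • vac φ ∈ W}
      zero_mem' := by simp
      add_mem' := fun {X Y} hX hY => by
        simp only [Set.mem_ofPred_eq, add_smul] at *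
        exact W.add_mem hX hY
      smul_mem' := fun c X hX => by
        simp only [Set.mem_ofPred_eq, smul_assoc] at *
        exact W.smul_of_tower_mem c hX }
  refine component_zero_mem C q hq hroot J (fun X hX i => ?_) hX
  have hKinv : Uq.Kinv C q i ∈ Uzero C q :=
    Ucartan_le_Uzero C q (Algebra.subset_adjoin (Or.inr ⟨i, rfl⟩))
  change (Uq.K C q i * X * Uq.Kinv C q i) • vac φ ∈ W
  rw [mul_smul, coe_smul_vac φ ⟨_, hKinv⟩, ← mul_smul, mul_smul_comm, mul_one, smul_assoc,
    mul_smul]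
  exact W.smul_of_tower_mem _ (W.smul_mem _ hX)

theorem component_zero_smul_vac (X : Uq C q) :
    component C q 0 X • vac φ = (extend hq φ X • (1 : Uq C q)) • vac φ :=
  coe_smul_vac φ ⟨component C q 0 X,
    (mem_Uzero_iff C q).2 (component_mem_rootSpace C q hq X 0)⟩

theorem isCoatom_radical (hroot : ∀ k : ℕ, 0 < k → q ^ k ≠ 1) : IsCoatom (radical hq φ) := by
  have hone : (1 : Uq C q) • vac φ ∉ radical hq φ := fun h => by
    have := (smul_vac_mem_radical hq φ hroot).1 h 1
    rw [mul_one, extend_one hq φ hroot] at this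
    exact one_ne_zero this
  refine ⟨fun h => hone (h ▸ Submodule.mem_top), fun W hW => ?_⟩
  obtain ⟨m, hm, hmN⟩ := Set.exists_of_ssubset hW
  obtain ⟨X, rfl⟩ := exists_smul_vac φ m
  rw [SetLike.mem_coe, smul_vac_mem_radical hq φ hroot] at hmN
  push Not at hmN
  obtain ⟨Y, hY⟩ := hmN
  have hYX : (Y * X) • vac φ ∈ W := by
    rw [mul_smul]
    exact W.smul_mem Y hm
  have h := component_zero_smul_vac_mem φ hq hroot W hYX
  rw [component_zero_smul_vac hq φ] at h
  have hvac : vac φ ∈ W := by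
    have := W.smul_of_tower_mem (extend hq φ (Y * X))⁻¹ h
    rwa [← smul_assoc, smul_smul, inv_mul_cancel₀ hY, one_smul, one_smul] at this
  refine eq_top_iff.2 fun m _ => ?_
  obtain ⟨Z, rfl⟩ := exists_smul_vac φ m
  exact W.smul_mem Z hvac

end Induced

/-! ### The inner product -/

section Form

variable {n : ℕ} {C : CartanDatum n} (T : StarDatum C) {q : ℝ} (hq : q ≠ 0)

theorem IsPositiveFunctional.apply_qStar {f : Uq C (q : ℂ) →ₗ[ℂ] ℂ}
    (hf : IsPositiveFunctional T hq f) (X : Uq C (q : ℂ)) :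
    f (qStar T q hq X) = starRingEnd ℂ (f X) := by
  -- Polarization: the values of `f` at `Z^* Z` for `Z = 1, X, 1 + X, 1 + i X` are real.
  have h1 := (Complex.nonneg_iff.1 (hf 1)).2
  have h2 := (Complex.nonneg_iff.1 (hf X)).2
  have h3 := (Complex.nonneg_iff.1 (hf (1 + X))).2
  have h4 := (Complex.nonneg_iff.1 (hf (1 + Complex.I • X))).2
  simp only [qStar_add, qStar_smul, qStar_one, mul_add, add_mul, one_mul, mul_one, map_add,
    map_smul, smul_mul_assoc, mul_smul_comm, smul_eq_mul, Complex.add_im,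
    Complex.mul_im, Complex.conj_I, Complex.neg_re, Complex.neg_im, Complex.I_re,
    Complex.I_im, Complex.mul_re] at h1 h2 h3 h4
  apply Complex.ext
  · rw [Complex.conj_re]
    linarith
  · rw [Complex.conj_im]
    linarith

/-- The positive semidefinite form `(Y, X) ↦ f(Y^* X)` of a positive functional `f`. -/
@[reducible]
def preCore {f : Uq C (q : ℂ) →ₗ[ℂ] ℂ} (hf : IsPositiveFunctional T hq f) :
    PreInnerProductSpace.Core ℂ (Uq C (q : ℂ)) where
  inner Y X := f (qStar T q hq Y * X)
  conj_inner_symm Y X := by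
    rw [← hf.apply_qStar, qStar_mul, qStar_qStar]
  re_inner_nonneg X := (Complex.nonneg_iff.1 (hf X)).1
  add_left X Y Z := by rw [qStar_add, add_mul, map_add]
  smul_left X Y c := by rw [qStar_smul, smul_mul_assoc, map_smul, smul_eq_mul]

theorem IsPositiveFunctional.apply_mul_eq_zero {f : Uq C (q : ℂ) →ₗ[ℂ] ℂ}
    (hf : IsPositiveFunctional T hq f) {X : Uq C (q : ℂ)} (hX : f (qStar T q hq X * X) = 0)
    (Y : Uq C (q : ℂ)) : f (Y * X) = 0 := by
  let _ := preCore T hq hf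
  have h := InnerProductSpace.Core.inner_mul_inner_self_le (𝕜 := ℂ) (qStar T q hq Y) X
  change ‖f (qStar T q hq (qStar T q hq Y) * X)‖ * ‖f (qStar T q hq X * qStar T q hq Y)‖ ≤
    _ * RCLike.re (f (qStar T q hq X * X)) at h
  rw [hX, map_zero, mul_zero, qStar_qStar, ← qStar_qStar T q hq (qStar T q hq X * _), qStar_mul,
    qStar_qStar, qStar_qStar, hf.apply_qStar, RCLike.norm_conj] at h
  exact norm_eq_zero.1 (mul_self_eq_zero.1 (le_antisymm h (mul_self_nonneg _)))

variable (φ : Uzero C (q : ℂ) →ₐ[ℂ] ℂ)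

theorem coe_radical_eq_nullSet
    (hpos : IsPositiveFunctional T hq (extend (Complex.ofReal_ne_zero.2 hq) φ)) :
    (radical (Complex.ofReal_ne_zero.2 hq) φ : Set (Mathieu C (q : ℂ) (OneDim φ))) =
      nullSet T hq φ := by
  ext m
  constructor
  · rintro ⟨X, rfl, hX⟩
    exact ⟨X, rfl, hX _⟩
  · rintro ⟨X, rfl, hX⟩
    exact ⟨X, rfl, fun Y => hpos.apply_mul_eq_zero T hq hX Y⟩

/-- The class of `X • (1 ⊗ 1)` modulo the radical. -/
def vacClass (X : Uq C (q : ℂ)) :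
    Mathieu C (q : ℂ) (OneDim φ) ⧸ radical (Complex.ofReal_ne_zero.2 hq) φ :=
  Submodule.Quotient.mk (X • vac φ)

theorem vacClass_surjective : Function.Surjective (vacClass hq φ) := fun u => by
  obtain ⟨m, rfl⟩ := Submodule.Quotient.mk_surjective _ u
  obtain ⟨X, rfl⟩ := exists_smul_vac φ m
  exact ⟨X, rfl⟩

theorem vacClass_add (X Y : Uq C (q : ℂ)) :
    vacClass hq φ (X + Y) = vacClass hq φ X + vacClass hq φ Y := by
  rw [vacClass, add_smul]; rfl

theorem vacClass_smul (c : ℂ) (X : Uq C (q : ℂ)) :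
    vacClass hq φ (c • X) = c • vacClass hq φ X := by
  rw [vacClass, smul_assoc]; rfl

theorem vacClass_mul (Y X : Uq C (q : ℂ)) :
    vacClass hq φ (Y * X) = Y • vacClass hq φ X := by
  rw [vacClass, mul_smul]; rfl

theorem extend_mul_congr (hroot : ∀ k : ℕ, 0 < k → (q : ℂ) ^ k ≠ 1) {X X' : Uq C (q : ℂ)}
    (h : vacClass hq φ X = vacClass hq φ X') (Y : Uq C (q : ℂ)) :
    extend (Complex.ofReal_ne_zero.2 hq) φ (Y * X) =
      extend (Complex.ofReal_ne_zero.2 hq) φ (Y * X') := by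
  have h' := (Submodule.Quotient.eq _).1 h
  rw [← sub_smul, smul_vac_mem_radical _ φ hroot] at h'
  have := h' Y
  rwa [mul_sub, map_sub, sub_eq_zero] at this

/-- The form on the quotient by the radical induced by `(Y, X) ↦ f(Y^* X)`, computed on chosen
representatives; see `quotientForm_vacClass` for the independence of the choice. -/
def quotientForm
    (u w : Mathieu C (q : ℂ) (OneDim φ) ⧸ radical (Complex.ofReal_ne_zero.2 hq) φ) : ℂ :=
  extend (Complex.ofReal_ne_zero.2 hq) φ
    (qStar T q hq (Function.surjInv (vacClass_surjective hq φ) u) *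
      Function.surjInv (vacClass_surjective hq φ) w)

theorem quotientForm_vacClass (hroot : ∀ k : ℕ, 0 < k → (q : ℂ) ^ k ≠ 1)
    (hpos : IsPositiveFunctional T hq (extend (Complex.ofReal_ne_zero.2 hq) φ))
    (Y X : Uq C (q : ℂ)) :
    quotientForm T hq φ (vacClass hq φ Y) (vacClass hq φ X) =
      extend (Complex.ofReal_ne_zero.2 hq) φ (qStar T q hq Y * X) := by
  have hinv := Function.surjInv_eq (vacClass_surjective hq φ)
  have hsymm := (preCore T hq hpos).conj_inner_symm
  rw [quotientForm, extend_mul_congr hq φ hroot (hinv (vacClass hq φ X))]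
  refine (hsymm _ X).symm.trans (Eq.trans (congrArg _ ?_) (hsymm Y X))
  exact extend_mul_congr hq φ hroot (hinv (vacClass hq φ Y)) _

/-- The inner product on the quotient of the rank one module by the radical. -/
@[reducible]
def quotientCore (hroot : ∀ k : ℕ, 0 < k → (q : ℂ) ^ k ≠ 1)
    (hpos : IsPositiveFunctional T hq (extend (Complex.ofReal_ne_zero.2 hq) φ)) :
    InnerProductSpace.Core ℂ
      (Mathieu C (q : ℂ) (OneDim φ) ⧸ radical (Complex.ofReal_ne_zero.2 hq) φ) where
  inner := quotientForm T hq φ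
  conj_inner_symm u w := by
    obtain ⟨X, rfl⟩ := vacClass_surjective hq φ u
    obtain ⟨Y, rfl⟩ := vacClass_surjective hq φ w
    rw [quotientForm_vacClass T hq φ hroot hpos, quotientForm_vacClass T hq φ hroot hpos]
    exact (preCore T hq hpos).conj_inner_symm X Y
  re_inner_nonneg u := by
    obtain ⟨X, rfl⟩ := vacClass_surjective hq φ u
    rw [quotientForm_vacClass T hq φ hroot hpos]
    exact (preCore T hq hpos).re_inner_nonneg X
  add_left u v w := by
    obtain ⟨X, rfl⟩ := vacClass_surjective hq φ u
    obtain ⟨Y, rfl⟩ := vacClass_surjective hq φ v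
    obtain ⟨Z, rfl⟩ := vacClass_surjective hq φ w
    rw [← vacClass_add]
    simp only [quotientForm_vacClass T hq φ hroot hpos]
    exact (preCore T hq hpos).add_left X Y Z
  smul_left u w c := by
    obtain ⟨X, rfl⟩ := vacClass_surjective hq φ u
    obtain ⟨Y, rfl⟩ := vacClass_surjective hq φ w
    rw [← vacClass_smul]
    simp only [quotientForm_vacClass T hq φ hroot hpos]
    exact (preCore T hq hpos).smul_left X Y c
  definite u h := by
    obtain ⟨X, rfl⟩ := vacClass_surjective hq φ u
    rw [quotientForm_vacClass T hq φ hroot hpos] at h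
    exact (Submodule.Quotient.mk_eq_zero _).2
      ((smul_vac_mem_radical _ φ hroot).2 fun Y => hpos.apply_mul_eq_zero T hq h Y)

theorem isUnitary_quotientCore (hroot : ∀ k : ℕ, 0 < k → (q : ℂ) ^ k ≠ 1)
    (hpos : IsPositiveFunctional T hq (extend (Complex.ofReal_ne_zero.2 hq) φ)) :
    IsUnitary T hq (quotientCore T hq φ hroot hpos) := by
  intro X u w
  obtain ⟨Y, rfl⟩ := vacClass_surjective hq φ u
  obtain ⟨Z, rfl⟩ := vacClass_surjective hq φ w
  change quotientForm T hq φ _ _ = quotientForm T hq φ _ _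
  rw [← vacClass_mul, ← vacClass_mul, quotientForm_vacClass T hq φ hroot hpos,
    quotientForm_vacClass T hq φ hroot hpos, qStar_mul, mul_assoc]

end Form

end QuantumMathieu

end

open QuantumMathieu in
theorem mainTheorem10 {n : ℕ} (C : CartanDatum n) (q : ℝ) (hq : q ≠ 0)
    (hroot : ∀ k : ℕ, 0 < k → q ^ k ≠ 1)
    (T : StarDatum C)
    (S : Finset (Fin n)) (hS : ∀ i ∈ S, ∀ j ∈ S, i ≠ j → C.A i j = 0)
    (lam : Ucartan C (q : ℂ) →ₐ[ℂ] ℂ) (mu : S → ℂ) (hmu : ∀ i, mu i ≠ 0)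
    (φ : Uzero C (q : ℂ) →ₐ[ℂ] ℂ)
    (hφ : IsRankOneRep (Complex.ofReal_ne_zero.2 hq) S lam mu φ)
    (hpos : IsPositiveFunctional T hq (extend (Complex.ofReal_ne_zero.2 hq) φ)) :
    ∃ N : Submodule (Uq C (q : ℂ)) (Mathieu C (q : ℂ) (OneDim φ)),
      (N : Set (Mathieu C (q : ℂ) (OneDim φ))) = nullSet T hq φ ∧
      IsSimpleModule (Uq C (q : ℂ)) (Mathieu C (q : ℂ) (OneDim φ) ⧸ N) ∧
      ∃ ip : InnerProductSpace.Core ℂ (Mathieu C (q : ℂ) (OneDim φ) ⧸ N),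
        IsUnitary T hq ip ∧
        ∀ X Y : Uq C (q : ℂ),
          ip.inner (Submodule.Quotient.mk (Y • vac φ)) (Submodule.Quotient.mk (X • vac φ)) =
            extend (Complex.ofReal_ne_zero.2 hq) φ (qStar T q hq Y * X) := by
  have hroot' : ∀ k : ℕ, 0 < k → (q : ℂ) ^ k ≠ 1 := fun k hk h =>
    hroot k hk (by exact_mod_cast h)
  exact ⟨radical (Complex.ofReal_ne_zero.2 hq) φ, coe_radical_eq_nullSet T hq φ hpos,
    isSimpleModule_iff_isCoatom.2 (isCoatom_radical (Complex.ofReal_ne_zero.2 hq) φ hroot'),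
    quotientCore T hq φ hroot' hpos, isUnitary_quotientCore T hq φ hroot' hpos,
    fun X Y => quotientForm_vacClass T hq φ hroot' hpos Y X⟩
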